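/- Let $(X,d,\mu)$ be a nonempty metric space with a Borel measure $\mu$ such that $0<V(x,r):=\mu(B(x,r))<\infty$ for all $x\in X$, $r>0$, and suppose that $\mu$ is doubling: there is $C_0\ge1$ with $V(x,2r)\le C_0V(x,r)$ for all $x\in X$, $r>0$. Let $X^+=X\times(0,\infty)$ carry the measure $d\mu(y)\,dt/t$. For $x\in X$ let $\Gamma(x)=\{(y,t)\in X^+: d(x,y)<t\}$, and for a ball $B\subset X$ let $T(B)=X^+\setminus\bigcup_{x\notin B}\Gamma(x)$. For a measurable function $f:X^+\to\mathbb C$ (functions being identified when they agree almost everywhere) put $$\mathcal A^\infty f(x)=\operatorname*{ess\,sup}_{(y,t)\in\Gamma(x)}|f(y,t)|,\qquad \|f\|_{T^{p,\infty}}=\Big(\int_X(\mathcal A^\infty f)^p\,d\mu\Big)^{1/p},$$ and let $T^{p,\infty}$ be the space of all such $f$ with $\|f\|_{T^{p,\infty}}<\infty$. Let $p\in(0,1]$. A measurable function $a:X^+\to\mathbb C$ is a $T^{p,\infty}$-atom if there is a ball $B$ such that $a$ vanishes almost everywhere outside $T(B)$ and $\|a\|_{L^\infty(X^+)}\le\mu(B)^{-1/p}$.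 Then a measurable function $f:X^+\to\mathbb C$ is in $T^{p,\infty}$ if and only if there are a sequence $(a_k)_{k\in\mathbb N}$ of $T^{p,\infty}$-atoms and a sequence $(\lambda_k)_{k\in\mathbb N}\in\ell^p(\mathbb N)$ of complex numbers such that $$f=\sum_{k\in\mathbb N}\lambda_ka_k\quad\text{with convergence in }T^{p,\infty}.\tag{$*$}$$ Furthermore, there is a constant $C\ge1$, independent of $f$, such that every $f\in T^{p,\infty}$ has a decomposition $(*)$ with $\|\lambda\|_{\ell^p(\mathbb N)}\le C\|f\|_{T^{p,\infty}}$, and $$C^{-1}\|f\|_{T^{p,\infty}}\le\inf\|\lambda\|_{\ell^p(\mathbb N)}\le C\|f\|_{T^{p,\infty}}\qquad\text{for all }f\in T^{p,\infty},$$ where the infimum is taken over all decompositions $(*)$ of $f$. -/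

import Mathlib

open MeasureTheory Filter Topology
open scoped ENNReal NNReal

noncomputable section

namespace TentSpace

variable {X : Type*} [MetricSpace X] [MeasurableSpace X]

/-- A Borel measure is nondegenerate if every ball has positive and finite volume. -/
def IsNondegenerate (μ : Measure X) : Prop :=
  ∀ (x : X) (r : ℝ), 0 < r → 0 < μ (Metric.ball x r) ∧ μ (Metric.ball x r) < ∞

/-- The (global) doubling condition `V(x, 2r) ≤ C V(x, r)`. -/
def IsDoubling (μ : Measure X) : Prop :=
  ∃ C : ℝ≥0, 1 ≤ C ∧ ∀ (x : X) (r : ℝ), 0 < r →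
    μ (Metric.ball x (2 * r)) ≤ (C : ℝ≥0∞) * μ (Metric.ball x r)

/-- The generalised half-space `X⁺ = X × (0, ∞)`. -/
abbrev HalfSpace (X : Type*) : Type _ := X × Set.Ioi (0 : ℝ)

/-- The product measure `dμ(y) dt/t` on the half-space. -/
def halfSpaceMeasure (μ : Measure X) : Measure (HalfSpace X) :=
  μ.prod (((volume : Measure ℝ).comap ((↑) : Set.Ioi (0 : ℝ) → ℝ)).withDensity
    fun t => ENNReal.ofReal (1 / (t : ℝ)))

/-- The cone `Γ(x) = {(y, t) : y ∈ B(x, t)}`. -/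
def cone (x : X) : Set (HalfSpace X) :=
  {z | z.1 ∈ Metric.ball x (z.2 : ℝ)}

/-- The tent over `B`: the complement of the union of the cones with vertex outside `B`. -/
def tent (B : Set X) : Set (HalfSpace X) :=
  (⋃ x ∈ Bᶜ, cone x)ᶜ

/-- The functional `𝒜^∞ f (x)`, the essential supremum of `|f|` over the cone `Γ(x)`. -/
def lusinInfty (μ : Measure X) (f : HalfSpace X → ℂ) (x : X) : ℝ≥0∞ :=
  essSup (fun z => ‖f z‖ₑ) ((halfSpaceMeasure μ).restrict (cone x))

/-- The `T^{p,∞}` quasi-norm: the `L^p(X)` quasi-norm of `𝒜^∞ f`, with values in `[0, ∞]`. -/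
def tentNorm (μ : Measure X) (p : ℝ) (f : HalfSpace X → ℂ) : ℝ≥0∞ :=
  (∫⁻ x, lusinInfty μ f x ^ p ∂μ) ^ (1 / p)

/-- Membership in the tent space `T^{p,∞}(X)`. -/
def MemTent (μ : Measure X) (p : ℝ) (f : HalfSpace X → ℂ) : Prop :=
  AEStronglyMeasurable f (halfSpaceMeasure μ) ∧ tentNorm μ p f < ∞

/-- `a` is a `T^{p,∞}`-atom: for some ball `B`, it is essentially supported in the tent over `B`
and `‖a‖_{L^∞(X⁺)} ≤ μ(B)^{-1/p}`. -/
def IsAtom (μ : Measure X) (p : ℝ) (a : HalfSpace X → ℂ) : Prop :=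
  AEStronglyMeasurable a (halfSpaceMeasure μ) ∧
    ∃ (c : X) (r : ℝ), 0 < r ∧
      halfSpaceMeasure μ {z | z ∉ tent (Metric.ball c r) ∧ a z ≠ 0} = 0 ∧
      eLpNorm a ∞ (halfSpaceMeasure μ) ≤ μ (Metric.ball c r) ^ (-(1 / p))

/-- The `ℓ^p(ℕ)` quasi-norm of a complex sequence, with values in `[0, ∞]`. -/
def ellNorm (p : ℝ) (lam : ℕ → ℂ) : ℝ≥0∞ :=
  (∑' k, ‖lam k‖ₑ ^ p) ^ (1 / p)

/-- `f = ∑ λ_k a_k` with `T^{p,∞}`-atoms `a_k`, with `λ ∈ ℓ^p(ℕ)`, and with the partial sums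
converging to `f` in the `T^{p,∞}` quasi-norm. -/
structure IsAtomicDecomposition (μ : Measure X) (p : ℝ) (f : HalfSpace X → ℂ)
    (lam : ℕ → ℂ) (a : ℕ → HalfSpace X → ℂ) : Prop where
  isAtom : ∀ k, IsAtom μ p (a k)
  mem_ell : ellNorm p lam < ∞
  tendsto : Tendsto
    (fun N => tentNorm μ p (fun z => f z - ∑ k ∈ Finset.range N, lam k * a k z)) atTop (𝓝 0)

/-- The infimum of `‖λ‖_{ℓ^p}` over all atomic decompositions of `f`. -/
def atomicNorm (μ : Measure X) (p : ℝ) (f : HalfSpace X → ℂ) : ℝ≥0∞ :=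
  ⨅ (lam : ℕ → ℂ) (a : ℕ → HalfSpace X → ℂ) (_ : IsAtomicDecomposition μ p f lam a),
    ellNorm p lam

end TentSpace

end

/-! For `p ≤ 1` the `p`-th power of the tent quasi-norm is countably subadditive, and an atom has
quasi-norm at most 1 because its `𝒜^∞` lives on the ball. Hence any atomic sum is controlled by the
`ℓ^p` norm of its coefficients (`IsAtomicDecomposition.tentNorm_le`).

Conversely, let `O_k` be the set where `(𝒜^∞ f)^p > 2^k`: it is open and has finite measure, and off
the tent over it `|f|^p ≤ 2^k` a.e. (`ae_le_of_notMem_tent`). Almost every point with `f ≠ 0` lies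
in some layer `tent O_k \ tent O_{k+1}` (`exists_mem_tent_levelSet_diff`). A Whitney argument covers
`tent O_k` by tents over balls of total measure at most `C^5 μ(O_k)` (`exists_tent_cover`). Cutting
the layers along these tents gives multiples of atoms with coefficients satisfying `∑ |λ|^p ≤ ∑
2^(k+1) C^5 μ(O_k) ≤ 4 C^5 ‖f‖^p`. -/

namespace TentSpace

/-! ### Cones, tents and countability -/

section Basic

variable {X : Type*} [MetricSpace X]

/-- A maximal disjoint subfamily of a family of nonempty sets: every member of the family meets a
member of the subfamily. -/
theorem exists_maximal_disjoint_subfamily {α ι : Type*} (B : ι → Set α) (t : Set ι)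
    (hne : ∀ a ∈ t, (B a).Nonempty) :
    ∃ u ⊆ t, u.PairwiseDisjoint B ∧ ∀ a ∈ t, ∃ b ∈ u, (B a ∩ B b).Nonempty := by
  obtain ⟨u, hut, hu, h⟩ := Vitali.exists_disjoint_subfamily_covering_enlargement B t
    (fun _ => 0) 2 one_lt_two (fun _ _ => le_rfl) 0 (fun _ _ => le_rfl) hne
  exact ⟨u, hut, hu, fun a ha => (h a ha).imp fun b hb => ⟨hb.1, hb.2.1⟩⟩

theorem isOpen_cone (x : X) : IsOpen (cone x) := by
  have : cone x = {z : HalfSpace X | dist z.1 x < (z.2 : ℝ)} := rfl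
  rw [this]
  exact isOpen_lt (by fun_prop) (by fun_prop)

theorem isClosed_tent (B : Set X) : IsClosed (tent B) :=
  (isOpen_biUnion fun x _ => isOpen_cone x).isClosed_compl

theorem notMem_tent_iff {B : Set X} {z : HalfSpace X} : z ∉ tent B ↔ ∃ x ∉ B, z ∈ cone x := by
  simp [tent]

theorem mem_tent_iff {B : Set X} {z : HalfSpace X} :
    z ∈ tent B ↔ Metric.ball z.1 (z.2 : ℝ) ⊆ B := by
  rw [← not_iff_not, notMem_tent_iff, Set.not_subset]
  simp only [cone, Set.mem_ofPred_eq, Metric.mem_ball, dist_comm z.1, and_comm]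

theorem mem_of_mem_tent {B : Set X} {z : HalfSpace X} (hz : z ∈ tent B) : z.1 ∈ B :=
  mem_tent_iff.1 hz (Metric.mem_ball_self z.2.2)

variable [MeasurableSpace X] {μ : Measure X}

theorem IsNondegenerate.sigmaFinite [Nonempty X] (h : IsNondegenerate μ) : SigmaFinite μ := by
  obtain ⟨x⟩ := ‹Nonempty X›
  refine ⟨⟨⟨fun n : ℕ => Metric.ball x (n + 1), fun _ => trivial,
    fun n => (h x _ (by positivity)).2, ?_⟩⟩⟩
  refine Set.eq_univ_of_forall fun y => Set.mem_iUnion.2 ?_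
  obtain ⟨n, hn⟩ := exists_nat_gt (dist y x)
  exact ⟨n, by rw [Metric.mem_ball]; linarith⟩

variable [BorelSpace X]

theorem IsNondegenerate.countable_of_pairwiseDisjoint_ball [SigmaFinite μ]
    (h : IsNondegenerate μ) {ι : Type*} {u : Set ι} {c : ι → X} {r : ι → ℝ}
    (hr : ∀ i ∈ u, 0 < r i) (hu : u.PairwiseDisjoint fun i => Metric.ball (c i) (r i)) :
    u.Countable := by
  have := Measure.countable_meas_pos_of_disjoint_iUnion (μ := μ)
    (As := fun i : u => Metric.ball (c i) (r i)) (fun i => measurableSet_ball)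
    (fun i j hij => hu i.2 j.2 fun hh => hij (Subtype.ext hh))
  have huniv : {i : u | 0 < μ (Metric.ball (c i) (r i))} = Set.univ :=
    Set.eq_univ_of_forall fun i => (h _ _ (hr i i.2)).1
  rw [huniv] at this
  exact Set.countable_coe_iff.1 (Set.countable_univ_iff.1 this)

theorem IsNondegenerate.secondCountableTopology [SigmaFinite μ] (h : IsNondegenerate μ) :
    SecondCountableTopology X := by
  refine Metric.secondCountable_of_almost_dense_set fun ε hε => ?_
  obtain ⟨u, -, hu, hmeet⟩ := exists_maximal_disjoint_subfamily
    (fun x : X => Metric.ball x (ε / 2)) Set.univ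
    fun x _ => ⟨x, Metric.mem_ball_self (half_pos hε)⟩
  refine ⟨u, h.countable_of_pairwiseDisjoint_ball (c := id) (fun _ _ => half_pos hε) hu,
    fun x => ?_⟩
  obtain ⟨y, hy, z, hz1, hz2⟩ := hmeet x trivial
  refine ⟨y, hy, ?_⟩
  rw [Metric.mem_ball] at hz1 hz2
  linarith [dist_triangle_left x y z]

end Basic

/-! ### The tent quasi-norm and the bound for atomic sums -/

section Norm

variable {X : Type*} [MetricSpace X] [MeasurableSpace X]
  {μ : Measure X} {p : ℝ}

theorem rpow_tsum_le_tsum_rpow {ι : Type*} (hp0 : 0 < p) (hp1 : p ≤ 1) (a : ι → ℝ≥0∞) :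
    (∑' i, a i) ^ p ≤ ∑' i, a i ^ p := by
  have hfin : ∀ s : Finset ι, (∑ i ∈ s, a i) ^ p ≤ ∑ i ∈ s, a i ^ p := fun s =>
    Finset.le_sum_of_subadditive (fun x : ℝ≥0∞ => x ^ p) (by simp [hp0])
      (fun x y => ENNReal.rpow_add_le_add_rpow x y hp0.le hp1) s a
  exact le_of_tendsto (ENNReal.summable.hasSum.ennrpow_const p)
    (Eventually.of_forall fun s => (hfin s).trans (ENNReal.sum_le_tsum s))

theorem tentNorm_rpow (hp0 : 0 < p) (f : HalfSpace X → ℂ) :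
    tentNorm μ p f ^ p = ∫⁻ x, lusinInfty μ f x ^ p ∂μ := by
  rw [tentNorm, ← ENNReal.rpow_mul, one_div_mul_cancel hp0.ne', ENNReal.rpow_one]

theorem ellNorm_rpow (hp0 : 0 < p) (lam : ℕ → ℂ) :
    ellNorm p lam ^ p = ∑' k, ‖lam k‖ₑ ^ p := by
  rw [ellNorm, ← ENNReal.rpow_mul, one_div_mul_cancel hp0.ne', ENNReal.rpow_one]

variable [BorelSpace X]

theorem lusinInfty_le_iff {f : HalfSpace X → ℂ} {x : X} {c : ℝ≥0∞} :
    lusinInfty μ f x ≤ c ↔ ∀ᵐ z ∂halfSpaceMeasure μ, z ∈ cone x → ‖f z‖ₑ ≤ c := by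
  rw [← ae_restrict_iff' (isOpen_cone x).measurableSet]
  refine ⟨fun h => ?_, fun h => essSup_le_of_ae_le _ h⟩
  filter_upwards [ENNReal.ae_le_essSup (μ := (halfSpaceMeasure μ).restrict (cone x))
    fun z => ‖f z‖ₑ] with z hz
  exact hz.trans h

theorem ae_le_lusinInfty (μ : Measure X) (f : HalfSpace X → ℂ) (x : X) :
    ∀ᵐ z ∂halfSpaceMeasure μ, z ∈ cone x → ‖f z‖ₑ ≤ lusinInfty μ f x :=
  lusinInfty_le_iff.1 le_rfl

/-- The cone at `x` is the countable union of the sets `d(z.1, x) + 1/(n+1) < z.2`, and each of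
these lies in the cone at every `y` within `1/(n+1)` of `x`. So a bound at points arbitrarily close
to `x` passes to `x`. -/
theorem lowerSemicontinuous_lusinInfty (μ : Measure X) (f : HalfSpace X → ℂ) :
    LowerSemicontinuous (lusinInfty μ f) := by
  refine lowerSemicontinuous_iff_isOpen_preimage.2 fun c => Metric.isOpen_iff.2 fun x hx => ?_
  by_contra! hcon
  refine not_le.2 (Set.mem_Ioi.1 hx) (lusinInfty_le_iff.2 ?_)
  have key : ∀ n : ℕ, ∀ᵐ z ∂halfSpaceMeasure μ,
      dist z.1 x + 1 / ((n : ℝ) + 1) < z.2 → ‖f z‖ₑ ≤ c := by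
    intro n
    obtain ⟨y, hy, hyc⟩ := Set.not_subset.1 (hcon (1 / ((n : ℝ) + 1)) (by positivity))
    filter_upwards [lusinInfty_le_iff.1 (not_lt.1 hyc)] with z hz hzx
    refine hz ?_
    rw [Metric.mem_ball, dist_comm] at hy
    simp only [cone, Set.mem_ofPred_eq, Metric.mem_ball]
    linarith [dist_triangle z.1 x y]
  filter_upwards [ae_all_iff.2 key] with z hz hzx
  simp only [cone, Set.mem_ofPred_eq, Metric.mem_ball] at hzx
  obtain ⟨n, hn⟩ := exists_nat_one_div_lt (sub_pos.2 hzx)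
  exact hz n (by linarith)

theorem measurable_lusinInfty (μ : Measure X) (f : HalfSpace X → ℂ) :
    Measurable (lusinInfty μ f) :=
  (lowerSemicontinuous_lusinInfty μ f).measurable

theorem lusinInfty_le_tsum {ι : Type*} [Countable ι] {f : HalfSpace X → ℂ}
    {g : ι → HalfSpace X → ℂ}
    (h : ∀ᵐ z ∂halfSpaceMeasure μ, ‖f z‖ₑ ≤ ∑' i, ‖g i z‖ₑ) (x : X) :
    lusinInfty μ f x ≤ ∑' i, lusinInfty μ (g i) x := by
  refine lusinInfty_le_iff.2 ?_
  filter_upwards [h, ae_all_iff.2 fun i => ae_le_lusinInfty μ (g i) x] with z hz hg hzx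
  exact hz.trans (ENNReal.tsum_le_tsum fun i => hg i hzx)

theorem tentNorm_rpow_le_tsum {ι : Type*} [Countable ι] (hp0 : 0 < p) (hp1 : p ≤ 1)
    {f : HalfSpace X → ℂ} {g : ι → HalfSpace X → ℂ}
    (h : ∀ᵐ z ∂halfSpaceMeasure μ, ‖f z‖ₑ ≤ ∑' i, ‖g i z‖ₑ) :
    tentNorm μ p f ^ p ≤ ∑' i, tentNorm μ p (g i) ^ p := by
  simp only [tentNorm_rpow hp0]
  rw [← lintegral_tsum fun i => ((measurable_lusinInfty μ (g i)).pow_const p).aemeasurable]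
  refine lintegral_mono fun x => ?_
  exact (ENNReal.rpow_le_rpow (lusinInfty_le_tsum h x) hp0.le).trans
    (rpow_tsum_le_tsum_rpow hp0 hp1 _)

theorem IsAtom.tentNorm_smul_rpow_le (hμ : IsNondegenerate μ) (hp0 : 0 < p)
    {a : HalfSpace X → ℂ} (ha : IsAtom μ p a) (l : ℂ) :
    tentNorm μ p (fun z => l * a z) ^ p ≤ ‖l‖ₑ ^ p := by
  obtain ⟨-, c, r, hr, hsupp, hbound⟩ := ha
  have hnorm : ∀ᵐ z ∂halfSpaceMeasure μ,
      ‖a z‖ₑ ≤ μ (Metric.ball c r) ^ (-(1 / p)) := by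
    filter_upwards [ENNReal.ae_le_essSup (μ := halfSpaceMeasure μ) fun z => ‖a z‖ₑ] with z hz
    rw [eLpNorm_exponent_top] at hbound
    exact hz.trans hbound
  have hzero : ∀ᵐ z ∂halfSpaceMeasure μ, z ∉ tent (Metric.ball c r) → a z = 0 := by
    rw [ae_iff]
    simpa only [Classical.not_imp] using hsupp
  have hpoint : ∀ x, lusinInfty μ (fun z => l * a z) x ^ p ≤
      (Metric.ball c r).indicator (fun _ => ‖l‖ₑ ^ p * (μ (Metric.ball c r))⁻¹) x := by
    intro x
    by_cases hx : x ∈ Metric.ball c r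
    · have : lusinInfty μ (fun z => l * a z) x ≤ ‖l‖ₑ * μ (Metric.ball c r) ^ (-(1 / p)) := by
        refine lusinInfty_le_iff.2 ?_
        filter_upwards [hnorm] with z hz _
        rw [enorm_mul]
        gcongr
      refine (ENNReal.rpow_le_rpow this hp0.le).trans_eq ?_
      rw [Set.indicator_of_mem hx, ENNReal.mul_rpow_of_nonneg _ _ hp0.le, ← ENNReal.rpow_mul,
        neg_mul, one_div_mul_cancel hp0.ne', ENNReal.rpow_neg_one]
    · have : lusinInfty μ (fun z => l * a z) x ≤ 0 := by
        refine lusinInfty_le_iff.2 ?_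
        filter_upwards [hzero] with z hz hzx
        rw [hz (notMem_tent_iff.2 ⟨x, hx, hzx⟩)]
        simp
      rw [nonpos_iff_eq_zero.1 this, Set.indicator_of_notMem hx, ENNReal.zero_rpow_of_pos hp0]
  rw [tentNorm_rpow hp0]
  refine (lintegral_mono hpoint).trans ?_
  rw [lintegral_indicator_const measurableSet_ball, mul_assoc,
    ENNReal.inv_mul_cancel (hμ c r hr).1.ne' (hμ c r hr).2.ne, mul_one]

theorem IsAtomicDecomposition.tentNorm_le (hμ : IsNondegenerate μ) (hp0 : 0 < p) (hp1 : p ≤ 1)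
    {f : HalfSpace X → ℂ} {lam : ℕ → ℂ} {a : ℕ → HalfSpace X → ℂ}
    (h : IsAtomicDecomposition μ p f lam a) : tentNorm μ p f ≤ ellNorm p lam := by
  rw [← ENNReal.rpow_le_rpow_iff hp0, ellNorm_rpow hp0]
  have hstep : ∀ N : ℕ, tentNorm μ p f ^ p ≤
      tentNorm μ p (fun z => f z - ∑ k ∈ Finset.range N, lam k * a k z) ^ p +
        ∑' k, ‖lam k‖ₑ ^ p := by
    intro N
    -- The remainder takes index 0 and the whole series follows; the terms beyond `N` only enlarge
    -- the bound.
    let g : ℕ → HalfSpace X → ℂ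
      | 0 => fun z => f z - ∑ k ∈ Finset.range N, lam k * a k z
      | k + 1 => fun z => lam k * a k z
    refine (tentNorm_rpow_le_tsum hp0 hp1 (g := g) (ae_of_all _ fun z => ?_)).trans ?_
    · rw [tsum_eq_zero_add' ENNReal.summable]
      calc ‖f z‖ₑ = ‖(f z - ∑ k ∈ Finset.range N, lam k * a k z) +
            ∑ k ∈ Finset.range N, lam k * a k z‖ₑ := by rw [sub_add_cancel]
        _ ≤ _ := (enorm_add_le _ _).trans (add_le_add le_rfl
            ((enorm_sum_le _ _).trans (ENNReal.sum_le_tsum _)))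
    · rw [tsum_eq_zero_add' ENNReal.summable]
      exact add_le_add le_rfl (ENNReal.tsum_le_tsum fun k =>
        (h.isAtom k).tentNorm_smul_rpow_le hμ hp0 (lam k))
  have hlim : Tendsto (fun N : ℕ =>
      tentNorm μ p (fun z => f z - ∑ k ∈ Finset.range N, lam k * a k z) ^ p +
        ∑' k, ‖lam k‖ₑ ^ p) atTop (𝓝 (0 ^ p + ∑' k, ‖lam k‖ₑ ^ p)) :=
    (h.tendsto.ennrpow_const p).add tendsto_const_nhds
  rw [ENNReal.zero_rpow_of_pos hp0, zero_add] at hlim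
  exact ge_of_tendsto' hlim hstep

end Norm

/-! ### Doubling and Whitney coverings -/

section Cover

variable {X : Type*} [MetricSpace X] [MeasurableSpace X] {μ : Measure X} {C : ℝ≥0}

theorem measure_ball_two_pow_mul_le
    (hC : ∀ (x : X) (r : ℝ), 0 < r →
      μ (Metric.ball x (2 * r)) ≤ (C : ℝ≥0∞) * μ (Metric.ball x r))
    (n : ℕ) (x : X) {r : ℝ} (hr : 0 < r) :
    μ (Metric.ball x (2 ^ n * r)) ≤ (C : ℝ≥0∞) ^ n * μ (Metric.ball x r) := by
  induction n with
  | zero => simp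
  | succ n ih =>
    rw [pow_succ', mul_assoc, pow_succ', mul_assoc]
    exact (hC x _ (by positivity)).trans (by gcongr)

variable [BorelSpace X]

/-- A doubling space of finite measure is bounded. -/
theorem exists_ball_eq_univ (hμ : IsNondegenerate μ)
    (hC : ∀ (x : X) (r : ℝ), 0 < r →
      μ (Metric.ball x (2 * r)) ≤ (C : ℝ≥0∞) * μ (Metric.ball x r))
    (hfin : μ Set.univ < ∞) (x₀ : X) : ∃ R : ℝ, 0 < R ∧ Metric.ball x₀ R = Set.univ := by
  by_contra! hcon
  let B : ℕ → Set X := fun n => Metric.ball x₀ (n + 1)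
  have hB : Monotone B := fun m n hmn => Metric.ball_subset_ball (by gcongr)
  have hU : ⋃ n, B n = Set.univ := by
    refine Set.eq_univ_of_forall fun y => Set.mem_iUnion.2 ?_
    obtain ⟨n, hn⟩ := exists_nat_gt (dist y x₀)
    exact ⟨n, Metric.mem_ball.2 (by linarith)⟩
  -- Around a point `y` at distance `d ≥ 2(n+1)` from `x₀`, the ball of radius `d/2` misses `B n`
  -- while that of radius `2d` contains it. As `n → ∞` this would force the total mass to be 0.
  have hle : ∀ n, μ (B n) ≤ (C : ℝ≥0∞) ^ 2 * μ (B n)ᶜ := by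
    intro n
    have hn : (0 : ℝ) < n + 1 := by positivity
    obtain ⟨y, hy⟩ := (Set.ne_univ_iff_exists_notMem _).1 (hcon (2 * (n + 1)) (by positivity))
    rw [Metric.mem_ball, not_lt] at hy
    have h1 : B n ⊆ Metric.ball y (2 ^ 2 * (dist y x₀ / 2)) := fun z hz => by
      rw [Metric.mem_ball] at hz ⊢
      linarith [dist_triangle_right z y x₀]
    have h2 : Metric.ball y (dist y x₀ / 2) ⊆ (B n)ᶜ := fun z hz hz' => by
      rw [Metric.mem_ball] at hz hz'
      linarith [dist_triangle_left y x₀ z]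
    exact (measure_mono h1).trans ((measure_ball_two_pow_mul_le hC 2 y (by linarith)).trans
      (by gcongr))
  have hlim₁ : Tendsto (fun n => μ (B n)) atTop (𝓝 (μ Set.univ)) := by
    rw [← hU]
    exact tendsto_measure_iUnion_atTop hB
  have hlim₂ : Tendsto (fun n => μ (B n)ᶜ) atTop (𝓝 0) := by
    have := tendsto_measure_iInter_atTop (μ := μ) (s := fun n => (B n)ᶜ)
      (fun n => measurableSet_ball.compl.nullMeasurableSet)
      (fun m n hmn => Set.compl_subset_compl.2 (hB hmn))
      ⟨0, ((measure_mono (Set.subset_univ _)).trans_lt hfin).ne⟩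
    rwa [← Set.compl_iUnion, hU, Set.compl_univ, measure_empty] at this
  have h0 := le_of_tendsto_of_tendsto' hlim₁
    (ENNReal.Tendsto.const_mul hlim₂ (Or.inr (by finiteness))) hle
  rw [mul_zero] at h0
  exact absurd ((hμ x₀ 1 one_pos).1.trans_le (measure_mono (Set.subset_univ _))) (not_lt.2 h0)

/-- A Whitney type covering of the tent over an open set of finite measure by tents over balls. -/
theorem exists_tent_cover [Nonempty X] (hμ : IsNondegenerate μ) (hC1 : 1 ≤ C)
    (hC : ∀ (x : X) (r : ℝ), 0 < r →
      μ (Metric.ball x (2 * r)) ≤ (C : ℝ≥0∞) * μ (Metric.ball x r))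
    {O : Set X} (hO : IsOpen O) (hfin : μ O < ∞) :
    ∃ (u : Set X) (r : X → ℝ), u.Countable ∧ (∀ y ∈ u, 0 < r y) ∧
      (∀ z ∈ tent O, ∃ y ∈ u, z ∈ tent (Metric.ball y (r y))) ∧
      ∑' y : u, μ (Metric.ball (y : X) (r y)) ≤ (C : ℝ≥0∞) ^ 5 * μ O := by
  have := hμ.sigmaFinite
  -- With an empty complement `Metric.infDist` is 0 and gives no radii; finite measure then makes
  -- the whole space a single ball.
  by_cases huniv : O = Set.univ
  · subst huniv
    obtain ⟨x₀⟩ := ‹Nonempty X›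
    obtain ⟨R, hR, hball⟩ := exists_ball_eq_univ hμ hC hfin x₀
    refine ⟨{x₀}, fun _ => R, Set.countable_singleton _, fun _ _ => hR,
      fun z hz => ⟨x₀, rfl, by rwa [hball]⟩, ?_⟩
    rw [tsum_singleton x₀ fun y => μ (Metric.ball y R), hball]
    exact le_mul_of_one_le_left' (one_le_pow₀ (by exact_mod_cast hC1))
  have hne : Oᶜ.Nonempty := Set.nonempty_compl.2 huniv
  let ρ : X → ℝ := fun y => Metric.infDist y Oᶜ
  have hρ : ∀ y ∈ O, 0 < ρ y := fun y hy =>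
    (hO.isClosed_compl.notMem_iff_infDist_pos hne).1 (Set.notMem_compl_iff.2 hy)
  obtain ⟨u, huO, hu, hmeet⟩ := exists_maximal_disjoint_subfamily
    (fun y : X => Metric.ball y (ρ y / 16)) O
    fun y hy => ⟨y, Metric.mem_ball_self (by linarith [hρ y hy])⟩
  have hr16 : ∀ y ∈ u, 0 < ρ y / 16 := fun y hy => by linarith [hρ y (huO hy)]
  have hucount : u.Countable := hμ.countable_of_pairwiseDisjoint_ball (c := id) hr16 hu
  -- If the small balls at `z.1` and `y` meet, `ρ` being 1-Lipschitz gives `d(z.1, y) < (2/15) ρ y`,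
  -- so `d(z.1, y) + ρ z.1 < 2 ρ y`. Since `2 ρ = 2^5 · ρ/16`, five doublings give `C^5`.
  refine ⟨u, fun y => 2 * ρ y, hucount, fun y hy => by linarith [hρ y (huO hy)], ?_, ?_⟩
  · intro z hz
    have hzO := mem_of_mem_tent hz
    obtain ⟨y, hy, w, hw1, hw2⟩ := hmeet z.1 hzO
    refine ⟨y, hy, mem_tent_iff.2 fun x hx => ?_⟩
    have ht : (z.2 : ℝ) ≤ ρ z.1 := by
      by_contra! hlt
      obtain ⟨x, hx, hxz⟩ := (Metric.infDist_lt_iff hne).1 hlt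
      exact hx (mem_tent_iff.1 hz (Metric.mem_ball'.2 hxz))
    have hlip : ρ z.1 ≤ ρ y + dist z.1 y := Metric.infDist_le_infDist_add_dist
    have hy0 := hρ y (huO hy)
    rw [Metric.mem_ball] at hw1 hw2 hx ⊢
    linarith [dist_triangle_left z.1 y w, dist_triangle x z.1 y]
  · calc ∑' y : u, μ (Metric.ball (y : X) (2 * ρ y))
        ≤ ∑' y : u, (C : ℝ≥0∞) ^ 5 * μ (Metric.ball (y : X) (ρ y / 16)) := by
          refine ENNReal.tsum_le_tsum fun y => ?_
          have := measure_ball_two_pow_mul_le hC 5 (y : X) (hr16 y y.2)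
          rwa [show (2 : ℝ) ^ 5 * (ρ y / 16) = 2 * ρ y by ring] at this
      _ = (C : ℝ≥0∞) ^ 5 * μ (⋃ y ∈ u, Metric.ball y (ρ y / 16)) := by
          rw [ENNReal.tsum_mul_left, measure_biUnion hucount hu fun _ _ => measurableSet_ball]
      _ ≤ _ := by
          gcongr
          refine Set.iUnion₂_subset fun y hy => ?_
          exact (Metric.ball_subset_ball (by linarith [hρ y (huO hy)])).trans
            Metric.ball_infDist_compl_subset

end Cover

/-! ### From a partition into tents to an atomic series -/

section Decomposition

variable {X : Type*} [MetricSpace X] [MeasurableSpace X] {μ : Measure X} {p : ℝ}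

theorem exists_disjoint_refinement {α ι : Type*} [MeasurableSpace α] [Countable ι]
    {G : ι → Set α} (hG : ∀ i, MeasurableSet (G i)) :
    ∃ F : ι → Set α, (∀ i, MeasurableSet (F i)) ∧ (∀ i, F i ⊆ G i) ∧
      (∀ i j z, z ∈ F i → z ∈ F j → i = j) ∧ ∀ i, ∀ z ∈ G i, ∃ j, z ∈ F j := by
  obtain ⟨e, he⟩ := exists_injective_nat ι
  refine ⟨fun i => G i \ ⋃ (j) (_ : e j < e i), G j,
    fun i => (hG i).diff (.iUnion fun j => .iUnion fun _ => hG j), fun i => Set.sdiff_subset,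
    fun i j z hi hj => ?_, fun i z hz => ?_⟩
  · simp only [Set.mem_sdiff, Set.mem_iUnion, not_exists] at hi hj
    rcases lt_trichotomy (e i) (e j) with h | h | h
    · exact (hj.2 i h hi.1).elim
    · exact he h
    · exact (hi.2 j h hj.1).elim
  · let P : ℕ → Prop := fun n => ∃ j, e j = n ∧ z ∈ G j
    classical
    have hP : ∃ n, P n := ⟨e i, i, rfl, hz⟩
    obtain ⟨j, hj, hzj⟩ := Nat.find_spec hP
    refine ⟨j, hzj, ?_⟩
    simp only [Set.mem_iUnion, not_exists]
    intro k hk hzk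
    exact Nat.find_min hP (hk.trans_eq hj) ⟨k, rfl, hzk⟩

theorem isAtom_zero [Nonempty X] : IsAtom μ p (fun _ => 0) := by
  obtain ⟨x⟩ := ‹Nonempty X›
  exact ⟨aestronglyMeasurable_const, x, 1, one_pos, by simp, by
    rw [eLpNorm_zero']
    exact zero_le⟩

/-- A bounded function supported in a tent is a multiple of an atom. -/
theorem exists_isAtom_of_ae_le (hμ : IsNondegenerate μ) (hp0 : 0 < p) {f : HalfSpace X → ℂ}
    (hf : AEStronglyMeasurable f (halfSpaceMeasure μ)) {F : Set (HalfSpace X)}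
    (hF : MeasurableSet F) {c : X} {r : ℝ} (hr : 0 < r) (hsub : F ⊆ tent (Metric.ball c r))
    {M : ℝ≥0∞} (hM0 : M ≠ 0) (hMtop : M ≠ ∞)
    (hbound : ∀ᵐ z ∂halfSpaceMeasure μ, z ∈ F → ‖f z‖ₑ ≤ M) :
    ∃ (l : ℂ) (a : HalfSpace X → ℂ), IsAtom μ p a ∧ (∀ z, l * a z = F.indicator f z) ∧
      ‖l‖ₑ ^ p = M ^ p * μ (Metric.ball c r) := by
  obtain ⟨hpos, hlt⟩ := hμ c r hr
  set V := μ (Metric.ball c r) with hV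
  have hV0 : V ^ (1 / p) ≠ 0 := (ENNReal.rpow_pos hpos hlt.ne).ne'
  have hVt : V ^ (1 / p) ≠ ∞ := ENNReal.rpow_ne_top_of_nonneg (by positivity) hlt.ne
  have hL0 : M * V ^ (1 / p) ≠ 0 := mul_ne_zero hM0 hV0
  have hLt : M * V ^ (1 / p) ≠ ∞ := ENNReal.mul_ne_top hMtop hVt
  -- Dividing by this scalar turns the bound `M` into the atomic bound `V ^ (-(1 / p))`.
  let l : ℂ := ((M * V ^ (1 / p)).toReal : ℂ)
  have hl : ‖l‖ₑ = M * V ^ (1 / p) := by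
    simp only [l, ← ofReal_norm, Complex.norm_real, Real.norm_eq_abs,
      abs_of_nonneg ENNReal.toReal_nonneg, ENNReal.ofReal_toReal hLt]
  have hl0 : l ≠ 0 := by
    intro h
    rw [h, enorm_zero] at hl
    exact hL0 hl.symm
  refine ⟨l, fun z => l⁻¹ * F.indicator f z, ⟨(hf.indicator hF).const_mul _, c, r, hr, ?_, ?_⟩,
    fun z => mul_inv_cancel_left₀ hl0 _, ?_⟩
  · convert measure_empty (μ := halfSpaceMeasure μ)
    refine Set.eq_empty_of_forall_notMem fun z hz => hz.2 ?_
    simp only [Set.indicator_of_notMem fun h => hz.1 (hsub h), mul_zero]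
  · rw [eLpNorm_exponent_top]
    refine essSup_le_of_ae_le _ ?_
    filter_upwards [hbound] with z hz
    by_cases hzF : z ∈ F
    · rw [Set.indicator_of_mem hzF, enorm_mul, enorm_inv hl0, hl, ENNReal.rpow_neg,
        ENNReal.mul_inv (Or.inl hM0) (Or.inl hMtop)]
      calc M⁻¹ * (V ^ (1 / p))⁻¹ * ‖f z‖ₑ ≤ M⁻¹ * (V ^ (1 / p))⁻¹ * M := by gcongr; exact hz hzF
        _ = (V ^ (1 / p))⁻¹ := by
          rw [mul_right_comm, ENNReal.inv_mul_cancel hM0 hMtop, one_mul]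
    · simp [Set.indicator_of_notMem hzF]
  · rw [hl, ENNReal.mul_rpow_of_nonneg _ _ hp0.le, ← ENNReal.rpow_mul,
      one_div_mul_cancel hp0.ne', ENNReal.rpow_one]

variable [BorelSpace X]

/-- A function which is bounded on each piece of a countable partition of its support, the pieces
being contained in tents, has an atomic decomposition. -/
theorem exists_isAtomicDecomposition_of_partition [Nonempty X] (hμ : IsNondegenerate μ)
    (hp0 : 0 < p) (hp1 : p ≤ 1) {f : HalfSpace X → ℂ}
    (hf : AEStronglyMeasurable f (halfSpaceMeasure μ)) {ι : Type*} [Countable ι]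
    {F : ι → Set (HalfSpace X)} (hF : ∀ i, MeasurableSet (F i))
    (hdisj : ∀ i j z, z ∈ F i → z ∈ F j → i = j) {c : ι → X} {r : ι → ℝ} (hr : ∀ i, 0 < r i)
    (hsub : ∀ i, F i ⊆ tent (Metric.ball (c i) (r i))) {M : ι → ℝ≥0∞} (hM0 : ∀ i, M i ≠ 0)
    (hMtop : ∀ i, M i ≠ ∞) (hbound : ∀ i, ∀ᵐ z ∂halfSpaceMeasure μ, z ∈ F i → ‖f z‖ₑ ≤ M i)
    (hcover : ∀ᵐ z ∂halfSpaceMeasure μ, f z ≠ 0 → ∃ i, z ∈ F i)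
    (hsum : ∑' i, M i ^ p * μ (Metric.ball (c i) (r i)) ≠ ∞) :
    ∃ (lam : ℕ → ℂ) (a : ℕ → HalfSpace X → ℂ), IsAtomicDecomposition μ p f lam a ∧
      ellNorm p lam ^ p = ∑' i, M i ^ p * μ (Metric.ball (c i) (r i)) := by
  choose l b hb hlb hl using fun i =>
    exists_isAtom_of_ae_le hμ hp0 hf (hF i) (hr i) (hsub i) (hM0 i) (hMtop i) (hbound i)
  obtain ⟨e, he⟩ := exists_injective_nat ι
  -- Indices outside the range of `e` receive coefficient 0 and the zero atom.
  let lam : ℕ → ℂ := Function.extend e l 0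
  let a : ℕ → HalfSpace X → ℂ := Function.extend e b fun _ _ => 0
  have ha : ∀ k, IsAtom μ p (a k) := by
    intro k
    by_cases hk : ∃ i, e i = k
    · obtain ⟨i, rfl⟩ := hk
      simpa only [a, he.extend_apply] using hb i
    · simpa only [a, Function.extend_apply' _ _ _ hk] using isAtom_zero
  have hellp : ∑' k, ‖lam k‖ₑ ^ p = ∑' i, M i ^ p * μ (Metric.ball (c i) (r i)) := by
    simp only [← hl]
    rw [← tsum_extend_zero he]
    congr 1 with k
    by_cases hk : ∃ i, e i = k
    · obtain ⟨i, rfl⟩ := hk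
      simp only [lam, he.extend_apply]
    · simp only [lam, Function.extend_apply' _ _ _ hk, Pi.zero_apply, enorm_zero,
        ENNReal.zero_rpow_of_pos hp0]
  have hell : ellNorm p lam ^ p = ∑' i, M i ^ p * μ (Metric.ball (c i) (r i)) := by
    rw [ellNorm_rpow hp0, hellp]
  have hhas : ∀ᵐ z ∂halfSpaceMeasure μ, HasSum (fun k => lam k * a k z) (f z) := by
    filter_upwards [hcover] with z hz
    have h1 : HasSum (fun i => (F i).indicator f z) (f z) := by
      by_cases h0 : f z = 0
      · have : (fun i => (F i).indicator f z) = fun _ => 0 := by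
          ext i
          simp [h0]
        rw [this, h0]
        exact hasSum_zero
      · obtain ⟨i, hi⟩ := hz h0
        have := hasSum_single (f := fun i => (F i).indicator f z) i fun j hj =>
          Set.indicator_of_notMem (fun h => hj (hdisj j i z h hi)) f
        rwa [Set.indicator_of_mem hi] at this
    rw [← hasSum_extend_zero he] at h1
    convert! h1 using 1
    ext k
    by_cases hk : ∃ i, e i = k
    · obtain ⟨i, rfl⟩ := hk
      simp only [lam, a, he.extend_apply, hlb]
    · simp only [lam, a, Function.extend_apply' _ _ _ hk, Pi.zero_apply, mul_zero]
  refine ⟨lam, a, ⟨ha, ?_, ?_⟩, hell⟩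
  · rw [lt_top_iff_ne_top]
    intro htop
    rw [htop, ENNReal.top_rpow_of_pos hp0] at hell
    exact hsum hell.symm
  -- The remainder is a.e. the pointwise tail of the series, so its quasi-norm is at most the `ℓ^p`
  -- tail of `lam`.
  · have hle : ∀ N : ℕ, tentNorm μ p (fun z => f z - ∑ k ∈ Finset.range N, lam k * a k z) ≤
        (∑' k, ‖lam (k + N)‖ₑ ^ p) ^ (1 / p) := by
      intro N
      rw [one_div, ENNReal.le_rpow_inv_iff hp0]
      refine (tentNorm_rpow_le_tsum hp0 hp1
        (g := fun k z => lam (k + N) * a (k + N) z) ?_).trans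
        (ENNReal.tsum_le_tsum fun k => (ha _).tentNorm_smul_rpow_le hμ hp0 _)
      filter_upwards [hhas] with z hz
      rw [← hz.tsum_eq, ← hz.summable.sum_add_tsum_nat_add N, add_sub_cancel_left]
      exact enorm_tsum_le_tsum_enorm
    have hlim : Tendsto (fun N : ℕ => (∑' k, ‖lam (k + N)‖ₑ ^ p) ^ (1 / p)) atTop
        (𝓝 (0 ^ (1 / p))) :=
      (ENNReal.tendsto_sum_nat_add (fun k => ‖lam k‖ₑ ^ p) (hellp ▸ hsum)).ennrpow_const _
    rw [ENNReal.zero_rpow_of_pos (by positivity)] at hlim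
    exact tendsto_of_tendsto_of_tendsto_of_le_of_le tendsto_const_nhds hlim
      (fun _ => zero_le) hle

end Decomposition

/-! ### Dyadic level sets and the decomposition of a given function -/

section Levels

/-- For `0 < s < ∞` the powers of 2 below `s` form a geometric series summing to twice the largest
of them. -/
theorem tsum_zpow_indicator_le (s : ℝ≥0∞) :
    ∑' k : ℤ, (if (2 : ℝ≥0∞) ^ k < s then (2 : ℝ≥0∞) ^ k else 0) ≤ 2 * s := by
  rcases eq_or_ne s 0 with rfl | h0
  · simp
  rcases eq_or_ne s ∞ with rfl | htop
  · simp
  obtain ⟨n, hn1, hn2⟩ := ENNReal.exists_mem_Ioc_zpow h0 htop ENNReal.one_lt_two (by simp)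
  let e : ℕ → ℤ := fun m => n - m
  have he : Function.Injective e := fun a b hab => by
    simp only [e] at hab
    omega
  rw [← he.tsum_eq (f := fun k : ℤ => if (2 : ℝ≥0∞) ^ k < s then (2 : ℝ≥0∞) ^ k else 0) ?_]
  · calc ∑' m : ℕ, (if (2 : ℝ≥0∞) ^ e m < s then (2 : ℝ≥0∞) ^ e m else 0)
        ≤ ∑' m : ℕ, 2 ^ n * (2⁻¹ : ℝ≥0∞) ^ m := by
          refine ENNReal.tsum_le_tsum fun m => ?_
          split_ifs
          · simp only [e]
            rw [ENNReal.zpow_sub (by simp) (by simp), zpow_natCast, ENNReal.inv_pow]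
          · exact zero_le
      _ = 2 * 2 ^ n := by rw [ENNReal.tsum_mul_left, ENNReal.tsum_geometric_two, mul_comm]
      _ ≤ 2 * s := by gcongr
  · intro k hk
    have hks : (2 : ℝ≥0∞) ^ k < s := by
      by_contra h
      simp [h] at hk
    have hkn : k ≤ n := by
      by_contra! h
      exact (hks.trans_le hn2).not_ge (ENNReal.zpow_le_of_le one_le_two h)
    exact ⟨(n - k).toNat, by simp only [e]; omega⟩

theorem tsum_zpow_mul_measure_le {α : Type*} [MeasurableSpace α] {μ : Measure α}
    {g : α → ℝ≥0∞} (hg : Measurable g) :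
    ∑' k : ℤ, (2 : ℝ≥0∞) ^ k * μ {x | 2 ^ k < g x} ≤ 2 * ∫⁻ x, g x ∂μ := by
  have hmeas : ∀ k : ℤ, MeasurableSet {x | 2 ^ k < g x} := fun k => hg measurableSet_Ioi
  have h : ∀ k : ℤ, (2 : ℝ≥0∞) ^ k * μ {x | 2 ^ k < g x} =
      ∫⁻ x, {x | 2 ^ k < g x}.indicator (fun _ => (2 : ℝ≥0∞) ^ k) x ∂μ := fun k =>
    (lintegral_indicator_const (hmeas k) _).symm
  simp only [h]
  rw [← lintegral_tsum fun k => (measurable_const.indicator (hmeas k)).aemeasurable,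
    ← lintegral_const_mul _ hg]
  refine lintegral_mono fun x => ?_
  simpa only [Set.indicator_apply, Set.mem_ofPred_eq] using tsum_zpow_indicator_le (g x)

variable {X : Type*} [MetricSpace X] [MeasurableSpace X] {μ : Measure X} {p : ℝ}

/-- The superlevel set `{(𝒜^∞ f)^p > 2^k}`. -/
def levelSet (μ : Measure X) (p : ℝ) (f : HalfSpace X → ℂ) (k : ℤ) : Set X :=
  {x | 2 ^ k < lusinInfty μ f x ^ p}

theorem levelSet_eq (hp0 : 0 < p) (f : HalfSpace X → ℂ) (k : ℤ) :
    levelSet μ p f k = {x | ((2 : ℝ≥0∞) ^ k) ^ p⁻¹ < lusinInfty μ f x} :=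
  Set.ext fun _ => (ENNReal.rpow_inv_lt_iff hp0).symm

variable [BorelSpace X]

/-- The complement of the tent is a possibly uncountable union of open cones; by Lindelöf countably
many suffice, so the exceptional sets still have null union. -/
theorem ae_le_of_notMem_tent [SecondCountableTopology X] (μ : Measure X) (f : HalfSpace X → ℂ)
    (c : ℝ≥0∞) :
    ∀ᵐ z ∂halfSpaceMeasure μ, z ∉ tent {x | c < lusinInfty μ f x} → ‖f z‖ₑ ≤ c := by
  obtain ⟨T, hT, hTc, hU⟩ := TopologicalSpace.isOpen_biUnion_countable
    {x | c < lusinInfty μ f x}ᶜ cone fun x _ => isOpen_cone x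
  have : ∀ x ∈ T, ∀ᵐ z ∂halfSpaceMeasure μ, z ∈ cone x → ‖f z‖ₑ ≤ c := fun x hx =>
    lusinInfty_le_iff.1 (not_lt.1 (hT hx))
  filter_upwards [(ae_ball_iff hTc).2 this] with z hz hzt
  have hzU : z ∈ ⋃ x ∈ {x | c < lusinInfty μ f x}ᶜ, cone x := Set.notMem_compl_iff.1 hzt
  rw [← hU] at hzU
  obtain ⟨x, hx, hzx⟩ := Set.mem_iUnion₂.1 hzU
  exact hz x hx hzx

theorem isOpen_levelSet (hp0 : 0 < p) (f : HalfSpace X → ℂ) (k : ℤ) :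
    IsOpen (levelSet μ p f k) := by
  rw [levelSet_eq hp0]
  exact (lowerSemicontinuous_lusinInfty μ f).isOpen_preimage _

theorem zpow_mul_measure_levelSet_le (hp0 : 0 < p) (f : HalfSpace X → ℂ) (k : ℤ) :
    2 ^ k * μ (levelSet μ p f k) ≤ tentNorm μ p f ^ p := by
  rw [tentNorm_rpow hp0]
  have hsub : levelSet μ p f k ⊆ {x | 2 ^ k ≤ lusinInfty μ f x ^ p} := fun x hx =>
    (show (2 : ℝ≥0∞) ^ k < lusinInfty μ f x ^ p from hx).le
  exact (mul_le_mul_right (measure_mono hsub) _).trans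
    (mul_meas_ge_le_lintegral ((measurable_lusinInfty μ f).pow_const p) _)

/-- Since `f z ≠ 0`, some level has `z` in its tent. Being in the tent at level `k` puts `B(z.1,
z.2)` inside the level set, so `2^k μ(B(z.1, z.2)) ≤ ‖f‖^p` by Chebyshev; the levels are thus
bounded above and the greatest one works. -/
theorem exists_mem_tent_levelSet_diff (hμ : IsNondegenerate μ) (hp0 : 0 < p)
    {f : HalfSpace X → ℂ} (hfin : tentNorm μ p f ^ p ≠ ∞) {z : HalfSpace X} (hz0 : f z ≠ 0)
    (hz : ∀ k : ℤ, z ∉ tent (levelSet μ p f k) → ‖f z‖ₑ ^ p ≤ 2 ^ k) :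
    ∃ k : ℤ, z ∈ tent (levelSet μ p f k) ∧ z ∉ tent (levelSet μ p f (k + 1)) := by
  have hpos : 0 < μ (Metric.ball z.1 (z.2 : ℝ)) := (hμ _ _ z.2.2).1
  have hmem : ∃ k : ℤ, z ∈ tent (levelSet μ p f k) := by
    have hf0 : ‖f z‖ₑ ^ p ≠ 0 := (ENNReal.rpow_pos (enorm_pos.2 hz0) enorm_ne_top).ne'
    obtain ⟨n, hn, -⟩ := ENNReal.exists_mem_Ioc_zpow hf0
      (ENNReal.rpow_ne_top_of_nonneg hp0.le enorm_ne_top) ENNReal.one_lt_two (by simp)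
    exact ⟨n, by_contra fun h => (hz n h).not_gt hn⟩
  have hbdd : ∃ b : ℤ, ∀ k : ℤ, z ∈ tent (levelSet μ p f k) → k ≤ b := by
    have htop : tentNorm μ p f ^ p / μ (Metric.ball z.1 (z.2 : ℝ)) ≠ ∞ :=
      ENNReal.div_ne_top hfin hpos.ne'
    -- Adding 1 keeps the bracketed number nonzero.
    obtain ⟨b, -, hb⟩ := ENNReal.exists_mem_Ico_zpow
      (x := tentNorm μ p f ^ p / μ (Metric.ball z.1 (z.2 : ℝ)) + 1) (by simp)
      (ENNReal.add_ne_top.2 ⟨htop, ENNReal.one_ne_top⟩) ENNReal.one_lt_two (by simp)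
    refine ⟨b + 1, fun k hk => ?_⟩
    by_contra! hlt
    have h1 : (2 : ℝ≥0∞) ^ k ≤ tentNorm μ p f ^ p / μ (Metric.ball z.1 (z.2 : ℝ)) := by
      rw [ENNReal.le_div_iff_mul_le (Or.inl hpos.ne') (Or.inr hfin)]
      exact (mul_le_mul_right (measure_mono (mem_tent_iff.1 hk)) _).trans
        (zpow_mul_measure_levelSet_le hp0 f k)
    exact ((h1.trans le_self_add).trans_lt hb).not_ge (ENNReal.zpow_le_of_le one_le_two hlt.le)
  obtain ⟨k, hk, hmax⟩ := Int.exists_greatest_of_bdd hbdd hmem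
  exact ⟨k, hk, fun h => absurd (hmax _ h) (by omega)⟩

theorem exists_isAtomicDecomposition [Nonempty X] (hμ : IsNondegenerate μ) (hp0 : 0 < p)
    (hp1 : p ≤ 1) {C : ℝ≥0} (hC1 : 1 ≤ C)
    (hC : ∀ (x : X) (r : ℝ), 0 < r →
      μ (Metric.ball x (2 * r)) ≤ (C : ℝ≥0∞) * μ (Metric.ball x r))
    {f : HalfSpace X → ℂ} (hf : MemTent μ p f) :
    ∃ (lam : ℕ → ℂ) (a : ℕ → HalfSpace X → ℂ), IsAtomicDecomposition μ p f lam a ∧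
      ellNorm p lam ^ p ≤ 4 * (C : ℝ≥0∞) ^ 5 * tentNorm μ p f ^ p := by
  have := hμ.sigmaFinite
  have := hμ.secondCountableTopology
  obtain ⟨hfm, hfin⟩ := hf
  have hfinp : tentNorm μ p f ^ p ≠ ∞ := ENNReal.rpow_ne_top_of_nonneg hp0.le hfin.ne
  have h2 : ∀ k : ℤ, 0 < (2 : ℝ≥0∞) ^ k ∧ (2 : ℝ≥0∞) ^ k < ∞ := fun k =>
    ⟨ENNReal.zpow_pos (by simp) (by simp) k, ENNReal.zpow_lt_top (by simp) (by simp) k⟩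
  have hOfin : ∀ k, μ (levelSet μ p f k) < ∞ := fun k =>
    ENNReal.lt_top_of_mul_ne_top_right
      ((zpow_mul_measure_levelSet_le hp0 f k).trans_lt hfinp.lt_top).ne (h2 k).1.ne'
  choose u r hucount hrpos hcov hsum using fun k : ℤ =>
    exists_tent_cover hμ hC1 hC (isOpen_levelSet hp0 f k) (hOfin k)
  have := fun k => (hucount k).to_subtype
  have hae : ∀ k : ℤ, ∀ᵐ z ∂halfSpaceMeasure μ, z ∉ tent (levelSet μ p f k) →
      ‖f z‖ₑ ≤ (2 ^ k) ^ p⁻¹ := fun k => by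
    rw [levelSet_eq hp0]
    exact ae_le_of_notMem_tent μ f _
  -- The covering tents may overlap within a layer, so the pieces are made disjoint.
  obtain ⟨F, hFm, hFG, hdisj, hFcov⟩ := exists_disjoint_refinement
    (G := fun i : Σ k : ℤ, u k => (tent (levelSet μ p f i.1) \ tent (levelSet μ p f (i.1 + 1))) ∩
      tent (Metric.ball (i.2 : X) (r i.1 i.2)))
    fun i => ((isClosed_tent _).measurableSet.diff (isClosed_tent _).measurableSet).inter
      (isClosed_tent _).measurableSet
  -- In the factor 4, one 2 comes from the bound `2^(k+1)` on layer `k`, the other from the dyadic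
  -- sum over levels.
  have htotal : ∑' i : Σ k : ℤ, u k,
      (((2 : ℝ≥0∞) ^ (i.1 + 1)) ^ p⁻¹) ^ p * μ (Metric.ball (i.2 : X) (r i.1 i.2)) ≤
        4 * (C : ℝ≥0∞) ^ 5 * tentNorm μ p f ^ p := by
    simp only [ENNReal.rpow_inv_rpow hp0.ne']
    rw [ENNReal.tsum_sigma fun (k : ℤ) (y : u k) =>
      (2 : ℝ≥0∞) ^ (k + 1) * μ (Metric.ball (y : X) (r k y))]
    calc ∑' (k : ℤ) (y : u k), (2 : ℝ≥0∞) ^ (k + 1) * μ (Metric.ball (y : X) (r k y))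
        ≤ ∑' k : ℤ, 2 * (C : ℝ≥0∞) ^ 5 * (2 ^ k * μ (levelSet μ p f k)) := by
          refine ENNReal.tsum_le_tsum fun k => ?_
          rw [ENNReal.tsum_mul_left, ENNReal.zpow_add (by simp) (by simp), zpow_one]
          refine (mul_le_mul_right (hsum k) _).trans_eq ?_
          ring
      _ ≤ 2 * (C : ℝ≥0∞) ^ 5 * (2 * tentNorm μ p f ^ p) := by
          rw [ENNReal.tsum_mul_left, tentNorm_rpow hp0]
          gcongr
          exact tsum_zpow_mul_measure_le ((measurable_lusinInfty μ f).pow_const p)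
      _ = _ := by ring
  have hbtop : 4 * (C : ℝ≥0∞) ^ 5 * tentNorm μ p f ^ p ≠ ∞ :=
    ENNReal.mul_ne_top (by finiteness) hfinp
  obtain ⟨lam, a, hdec, hell⟩ := exists_isAtomicDecomposition_of_partition hμ hp0 hp1 hfm
    hFm hdisj (c := fun i => (i.2 : X)) (r := fun i => r i.1 i.2) (fun i => hrpos _ _ i.2.2)
    (fun i => (hFG i).trans Set.inter_subset_right)
    (M := fun i => ((2 : ℝ≥0∞) ^ (i.1 + 1)) ^ p⁻¹)
    (fun i => (ENNReal.rpow_pos (h2 _).1 (h2 _).2.ne).ne')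
    (fun i => ENNReal.rpow_ne_top_of_nonneg (by positivity) (h2 _).2.ne)
    (fun i => (hae (i.1 + 1)).mono fun z hz hzF => hz (hFG i hzF).1.2)
    (by
      filter_upwards [ae_all_iff.2 hae] with z hz hz0
      obtain ⟨k, hk, hk'⟩ := exists_mem_tent_levelSet_diff hμ hp0 hfinp hz0 fun k hk =>
        (ENNReal.le_rpow_inv_iff hp0).1 (hz k hk)
      obtain ⟨y, hy, hzy⟩ := hcov k z hk
      exact hFcov ⟨k, y, hy⟩ z ⟨⟨hk, hk'⟩, hzy⟩)
    (htotal.trans_lt hbtop.lt_top).ne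
  exact ⟨lam, a, hdec, hell.trans_le htotal⟩

end Levels

end TentSpace

theorem mainTheorem7 {X : Type*} [MetricSpace X] [Nonempty X] [MeasurableSpace X] [BorelSpace X]
    (μ : Measure X) (hnondeg : TentSpace.IsNondegenerate μ) (hdoubling : TentSpace.IsDoubling μ)
    (p : ℝ) (hp0 : 0 < p) (hp1 : p ≤ 1) :
    (∀ f : TentSpace.HalfSpace X → ℂ,
      AEStronglyMeasurable f (TentSpace.halfSpaceMeasure μ) →
        (TentSpace.MemTent μ p f ↔
          ∃ (lam : ℕ → ℂ) (a : ℕ → TentSpace.HalfSpace X → ℂ),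
            TentSpace.IsAtomicDecomposition μ p f lam a)) ∧
    ∃ C : ℝ≥0, 1 ≤ C ∧
      ∀ f : TentSpace.HalfSpace X → ℂ, TentSpace.MemTent μ p f →
        (∃ (lam : ℕ → ℂ) (a : ℕ → TentSpace.HalfSpace X → ℂ),
          TentSpace.IsAtomicDecomposition μ p f lam a ∧
            TentSpace.ellNorm p lam ≤ C * TentSpace.tentNorm μ p f) ∧
        TentSpace.tentNorm μ p f ≤ C * TentSpace.atomicNorm μ p f ∧
        TentSpace.atomicNorm μ p f ≤ C * TentSpace.tentNorm μ p f := by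
  obtain ⟨C, hC1, hC⟩ := hdoubling
  let K : ℝ≥0 := (4 * C ^ 5) ^ p⁻¹
  have hK1 : 1 ≤ K := NNReal.one_le_rpow
    (one_le_mul_of_one_le_of_one_le (by norm_num) (one_le_pow₀ hC1)) (inv_nonneg.2 hp0.le)
  have hKp : (K : ℝ≥0∞) ^ p = 4 * (C : ℝ≥0∞) ^ 5 := by
    rw [← ENNReal.coe_rpow_of_nonneg _ hp0.le, NNReal.rpow_inv_rpow hp0.ne']
    push_cast
    rfl
  have hex : ∀ f : TentSpace.HalfSpace X → ℂ, TentSpace.MemTent μ p f →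
      ∃ (lam : ℕ → ℂ) (a : ℕ → TentSpace.HalfSpace X → ℂ),
        TentSpace.IsAtomicDecomposition μ p f lam a ∧
          TentSpace.ellNorm p lam ≤ K * TentSpace.tentNorm μ p f := by
    intro f hf
    obtain ⟨lam, a, hdec, hle⟩ :=
      TentSpace.exists_isAtomicDecomposition hnondeg hp0 hp1 hC1 hC hf
    refine ⟨lam, a, hdec, ?_⟩
    rwa [← ENNReal.rpow_le_rpow_iff hp0, ENNReal.mul_rpow_of_nonneg _ _ hp0.le, hKp]
  refine ⟨fun f hf => ⟨fun h => ?_, ?_⟩, K, hK1, fun f hf => ⟨hex f hf, ?_, ?_⟩⟩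
  · obtain ⟨lam, a, hdec, -⟩ := hex f h
    exact ⟨lam, a, hdec⟩
  · rintro ⟨lam, a, hdec⟩
    exact ⟨hf, (hdec.tentNorm_le hnondeg hp0 hp1).trans_lt hdec.mem_ell⟩
  -- This inequality holds already with constant 1.
  · refine le_trans ?_ (le_mul_of_one_le_left' (by exact_mod_cast hK1))
    exact le_iInf fun lam => le_iInf fun a => le_iInf fun hdec =>
      hdec.tentNorm_le hnondeg hp0 hp1
  · obtain ⟨lam, a, hdec, hle⟩ := hex f hf
    refine le_trans ?_ hle
    rw [TentSpace.atomicNorm]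
    exact iInf_le_of_le lam (iInf_le_of_le a (iInf_le _ hdec))
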